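/- Let $\Phi(u)=\int_0^u\phi(t)\,dt$, $u\ge 0$, be a Young function: $\phi(0)=0$, $\phi(t)>0$ for $t>0$, $\phi$ is nondecreasing and right continuous on $[0,\infty)$, $\phi(t)\to\infty$ as $t\to\infty$, and there is $a>1$ with $u\phi(u)<a\Phi(u)$ for all $u>0$. Let $\Omega\subset\mathbb{R}^d$ be open, let $L_\Phi(\Omega)$ be the Orlicz space of (classes of) measurable $u:\Omega\to\mathbb{R}$ with $\int_\Omega\Phi(|u|)\,dx<\infty$, with the Luxemburg norm $\|u\|=\inf\{\lambda>0:\int_\Omega\Phi(|u|/\lambda)\,dx\le 1\}$, let $A\subset\Omega$, and let $\mathcal{A}(A)$ be the family of open subsets of $A$. Write $U'\subset\subset U$ if $\overline{U'}$ is compact and contained in $U$; a cut-off function between $U'$ and $U$ is a $\varphi\in C_0^\infty(\mathbb{R}^d)$ with $\operatorname{spt}\varphi\subset U$, $0\le\varphi\le1$ and $\varphi=1$ on $U'$. Let $(F_n)_{n>0}$ be a family of functionals $F_n:L_\Phi(\Omega)\times\mathcal{A}(A)\to[-\infty,\infty]$ (indexed by real $n>0$) that satisfies the fundamental $L_\Phi$-estimate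 as $n\to0$: for all $U,U',V\in\mathcal{A}(A)$ with $U'\subset\subset U$ and every $\sigma>0$ there are $M_\sigma>0$ and $n_\sigma>0$ such that for all $0<n\le n_\sigma$ and all $u,v\in L_\Phi(\Omega)$ there is a cut-off function $\varphi$ between $U'$ and $U$ with \[F_n(\varphi u+(1-\varphi)v,U'\cup V)\le(1+\sigma)\bigl(F_n(u,U)+F_n(v,V)\bigr)+M_\sigma\int_{(U\cap V)\setminus U'}\Phi(|u-v|)\,dx+\sigma ,\] whenever the sum $F_n(u,U)+F_n(v,V)$ is not of the form $\infty-\infty$. Let $(n_j)$ be a sequence of positive numbers converging to $0$, and put \[F'(u,U)=\inf\Bigl\{\liminf_{j\to\infty}F_{n_j}(u_j,U):u_j\to u\text{ in }L_\Phi(\Omega)\Bigr\},\qquad F''(u,U)=\inf\Bigl\{\limsup_{j\to\infty}F_{n_j}(u_j,U):u_j\to u\text{ in }L_\Phi(\Omega)\Bigr\}.\] Then for all $u\in L_\Phi(\Omega)$ and all $U,U',V\in\mathcal{A}(A)$ with $U'\subset\subset U$, \[F'(u,U'\cup V)\le F'(u,U)+F''(u,V)\qquad\text{and}\qquad F''(u,U'\cup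 V)\le F''(u,U)+F''(u,V),\] each inequality being claimed whenever its right-hand side is not of the form $\infty-\infty$. -/

import Mathlib

open MeasureTheory Filter Topology TopologicalSpace
open scoped ENNReal ContDiff

noncomputable section

/-- A Young function `Φ(u) = ∫₀ᵘ φ(t) dt` together with its density `φ`. Only the values on
`[0, ∞)` matter. -/
structure YoungFunction where
  /-- The function `Φ`. -/
  toFun : ℝ → ℝ
  /-- The density `φ`. -/
  density : ℝ → ℝ
  density_zero : density 0 = 0
  density_pos : ∀ t : ℝ, 0 < t → 0 < density t
  density_mono : MonotoneOn density (Set.Ici 0)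
  density_rightCont : ∀ t : ℝ, 0 ≤ t → ContinuousWithinAt density (Set.Ici t) t
  density_atTop : Tendsto density atTop atTop
  eq_integral : ∀ u : ℝ, 0 ≤ u → toFun u = ∫ t in (0 : ℝ)..u, density t
  growth : ∃ a : ℝ, 1 < a ∧ ∀ u : ℝ, 0 < u → u * density u < a * toFun u

namespace YoungFunction

instance : CoeFun YoungFunction (fun _ => ℝ → ℝ) := ⟨YoungFunction.toFun⟩

lemma monotoneOn (Φ : YoungFunction) : MonotoneOn Φ (Set.Ici 0) := by
  intro a ha b hb hab
  have ha0 : (0 : ℝ) ≤ a := ha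
  have hb0 : (0 : ℝ) ≤ b := hb
  have hint : ∀ c d : ℝ, 0 ≤ c → 0 ≤ d → IntervalIntegrable Φ.density volume c d := by
    intro c d hc hd
    refine MonotoneOn.intervalIntegrable (Φ.density_mono.mono ?_)
    intro x hx
    exact le_trans (le_min hc hd) hx.1
  have hadd := intervalIntegral.integral_add_adjacent_intervals
    (hint 0 a le_rfl ha0) (hint a b ha0 hb0)
  have hnn : 0 ≤ ∫ t in a..b, Φ.density t := by
    refine intervalIntegral.integral_nonneg hab ?_
    intro t ht
    rcases (ha0.trans ht.1).eq_or_lt with h | h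
    · rw [← h, Φ.density_zero]
    · exact (Φ.density_pos t h).le
  rw [Φ.eq_integral a ha0, Φ.eq_integral b hb0]
  linarith

lemma measurable_comp_abs (Φ : YoungFunction) : Measurable (fun x : ℝ => Φ |x|) := by
  have hm : Monotone (fun x : ℝ => Φ (max x 0)) := by
    intro a b hab
    exact Φ.monotoneOn (le_max_right a 0) (le_max_right b 0) (max_le_max_right 0 hab)
  have h := hm.measurable.comp (measurable_norm (α := ℝ))
  have he : (fun x : ℝ => Φ |x|) = (fun x : ℝ => Φ (max x 0)) ∘ norm := by
    funext x
    simp [Real.norm_eq_abs]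
  rw [he]
  exact h

end YoungFunction

/-- The Euclidean space `ℝᵈ`. -/
abbrev Euc (d : ℕ) : Type := EuclideanSpace ℝ (Fin d)

/-- Classes of measurable real functions on `Ω`, modulo equality a.e. in `Ω`. -/
abbrev MeasClass {d : ℕ} (Ω : Opens (Euc d)) : Type :=
  Euc d →ₘ[volume.restrict (Ω : Set (Euc d))] ℝ

/-- The modular `ρ(f, Φ, S) = ∫_S Φ(|f(x)|) dx`. -/
def orliczModular {d : ℕ} (Φ : YoungFunction) (S : Set (Euc d)) (f : Euc d → ℝ) : ℝ≥0∞ :=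
  ∫⁻ x in S, ENNReal.ofReal (Φ |f x|)

/-- The Luxemburg norm `inf {c > 0 : ∫_S Φ(|f(x)| / c) dx ≤ 1}`, with value `∞` when there is no
such `c` (which does not happen on the Orlicz space). -/
def luxemburgNorm {d : ℕ} (Φ : YoungFunction) (S : Set (Euc d)) (f : Euc d → ℝ) : ℝ≥0∞ :=
  ⨅ (c : ℝ) (_ : 0 < c ∧ orliczModular Φ S (fun x => f x / c) ≤ 1), ENNReal.ofReal c

/-- The Orlicz space `L_Φ(Ω)`: classes of measurable functions on `Ω` with
`∫_Ω Φ(|u|) dx < ∞`. -/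
def OrliczSpace {d : ℕ} (Φ : YoungFunction) (Ω : Opens (Euc d)) : Type :=
  {u : MeasClass Ω // orliczModular Φ (Ω : Set (Euc d)) u < ⊤}

/-- Norm convergence `u_j → u` in `L_Φ(Ω)`. -/
def OrliczTendsto {d : ℕ} {Φ : YoungFunction} {Ω : Opens (Euc d)}
    (u : ℕ → OrliczSpace Φ Ω) (u₀ : OrliczSpace Φ Ω) : Prop :=
  Tendsto (fun j => luxemburgNorm Φ (Ω : Set (Euc d)) ((u j).1 - u₀.1 : MeasClass Ω))
    atTop (𝓝 0)

/-- `U' ⊂⊂ U`: the closure of `U'` is compact and contained in `U`. -/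
def CompactlyContained {d : ℕ} (U' U : Opens (Euc d)) : Prop :=
  IsCompact (closure (U' : Set (Euc d))) ∧ closure (U' : Set (Euc d)) ⊆ (U : Set (Euc d))

/-- A cut-off function between `U'` and `U`. -/
structure CutOff {d : ℕ} (U' U : Opens (Euc d)) where
  /-- The underlying function. -/
  toFun : Euc d → ℝ
  smooth : ContDiff ℝ ∞ toFun
  compactSupport : HasCompactSupport toFun
  support_subset : tsupport toFun ⊆ (U : Set (Euc d))
  nonneg : ∀ x, 0 ≤ toFun x
  le_one : ∀ x, toFun x ≤ 1
  eq_one : ∀ x ∈ U', toFun x = 1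

/-- The class of a cut-off function on `Ω`. -/
def CutOff.toClass {d : ℕ} {U' U : Opens (Euc d)} (φ : CutOff U' U) (Ω : Opens (Euc d)) :
    MeasClass Ω :=
  AEEqFun.mk φ.toFun φ.smooth.continuous.aestronglyMeasurable

lemma CutOff.modular_blend_lt_top {d : ℕ} {Φ : YoungFunction} {Ω U' U : Opens (Euc d)}
    (φ : CutOff U' U) (u v : OrliczSpace Φ Ω) :
    orliczModular Φ (Ω : Set (Euc d))
      (φ.toClass Ω * u.1 + (1 - φ.toClass Ω) * v.1 : MeasClass Ω) < ⊤ := by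
  have hmeas : AEMeasurable (fun x => ENNReal.ofReal (Φ |u.1 x|))
      (volume.restrict (Ω : Set (Euc d))) :=
    (Φ.measurable_comp_abs.comp_aemeasurable u.1.aestronglyMeasurable.aemeasurable).ennreal_ofReal
  have hle : orliczModular Φ (Ω : Set (Euc d))
      (φ.toClass Ω * u.1 + (1 - φ.toClass Ω) * v.1 : MeasClass Ω) ≤
      orliczModular Φ (Ω : Set (Euc d)) u.1 + orliczModular Φ (Ω : Set (Euc d)) v.1 := by
    unfold orliczModular
    rw [← lintegral_add_left' hmeas]
    refine lintegral_mono_ae ?_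
    filter_upwards [AEEqFun.coeFn_add (φ.toClass Ω * u.1) ((1 - φ.toClass Ω) * v.1),
      AEEqFun.coeFn_mul (φ.toClass Ω) u.1, AEEqFun.coeFn_mul (1 - φ.toClass Ω) v.1,
      AEEqFun.coeFn_sub 1 (φ.toClass Ω),
      (AEEqFun.coeFn_one : ((1 : MeasClass Ω) : Euc d → ℝ) =ᵐ[_] 1),
      AEEqFun.coeFn_mk φ.toFun φ.smooth.continuous.aestronglyMeasurable] with x h1 h2 h3 h4 h5 h6
    have h6' : (φ.toClass Ω) x = φ.toFun x := h6
    simp only [h1, Pi.add_apply, h2, Pi.mul_apply, h3, h4, Pi.sub_apply, h5, Pi.one_apply, h6']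
    have p0 := φ.nonneg x
    have p1 := φ.le_one x
    have hb : |φ.toFun x * u.1 x + (1 - φ.toFun x) * v.1 x| ≤ max |u.1 x| |v.1 x| := by
      calc |φ.toFun x * u.1 x + (1 - φ.toFun x) * v.1 x|
          ≤ |φ.toFun x * u.1 x| + |(1 - φ.toFun x) * v.1 x| := abs_add_le _ _
        _ = φ.toFun x * |u.1 x| + (1 - φ.toFun x) * |v.1 x| := by
            rw [abs_mul, abs_mul, abs_of_nonneg p0, abs_of_nonneg (sub_nonneg.2 p1)]
        _ ≤ φ.toFun x * max |u.1 x| |v.1 x| + (1 - φ.toFun x) * max |u.1 x| |v.1 x| :=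
            add_le_add (mul_le_mul_of_nonneg_left (le_max_left _ _) p0)
              (mul_le_mul_of_nonneg_left (le_max_right _ _) (sub_nonneg.2 p1))
        _ = max |u.1 x| |v.1 x| := by ring
    rcases le_total |u.1 x| |v.1 x| with h | h
    · rw [max_eq_right h] at hb
      exact (ENNReal.ofReal_le_ofReal
        (Φ.monotoneOn (Set.mem_Ici.2 (abs_nonneg _)) (Set.mem_Ici.2 (abs_nonneg _)) hb)).trans le_add_self
    · rw [max_eq_left h] at hb
      exact (ENNReal.ofReal_le_ofReal
        (Φ.monotoneOn (Set.mem_Ici.2 (abs_nonneg _)) (Set.mem_Ici.2 (abs_nonneg _)) hb)).trans le_self_add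
  exact hle.trans_lt (ENNReal.add_lt_top.2 ⟨u.2, v.2⟩)

/-- The function `φ u + (1 - φ) v`, as an element of `L_Φ(Ω)`. -/
def CutOff.blend {d : ℕ} {Φ : YoungFunction} {Ω U' U : Opens (Euc d)}
    (φ : CutOff U' U) (u v : OrliczSpace Φ Ω) : OrliczSpace Φ Ω :=
  ⟨φ.toClass Ω * u.1 + (1 - φ.toClass Ω) * v.1, φ.modular_blend_lt_top u v⟩

/-- The sum `a + b` of extended reals is meaningful, i.e. not of the form `∞ - ∞`. -/
def SumDefined (a b : EReal) : Prop :=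
  ¬ (a = ⊤ ∧ b = ⊥) ∧ ¬ (a = ⊥ ∧ b = ⊤)

/-- The fundamental `L_Φ`-estimate for a family `(F_n)_{n > 0}` of functionals on
`L_Φ(Ω) × 𝒜(A)`, as `n → 0`, where `𝒜(A)` is the family of open subsets of `A`. The inequality is
only required for those `u`, `v` for which its right-hand side is meaningful. -/
def FundamentalEstimate {d : ℕ} {Φ : YoungFunction} {Ω : Opens (Euc d)} (A : Set (Euc d))
    (F : ℝ → OrliczSpace Φ Ω → Opens (Euc d) → EReal) : Prop :=
  ∀ U U' V : Opens (Euc d), (U : Set (Euc d)) ⊆ A → (U' : Set (Euc d)) ⊆ A →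
    (V : Set (Euc d)) ⊆ A → CompactlyContained U' U →
    ∀ σ : ℝ, 0 < σ → ∃ M : ℝ, 0 < M ∧ ∃ n₀ : ℝ, 0 < n₀ ∧ ∀ n : ℝ, 0 < n → n ≤ n₀ →
      ∀ u v : OrliczSpace Φ Ω, SumDefined (F n u U) (F n v V) →
        ∃ φ : CutOff U' U,
          F n (φ.blend u v) (U' ⊔ V) ≤
            ((1 + σ : ℝ) : EReal) * (F n u U + F n v V)
              + (M : EReal) * ((orliczModular Φ (((U : Set (Euc d)) ∩ V) \ U')
                  (u.1 - v.1 : MeasClass Ω) : ℝ≥0∞) : EReal)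
              + (σ : EReal)

/-- The `Γ(L_Φ)`-lower limit: the infimum of `liminf_j F_j(u_j)` over all `u_j → u` in
`L_Φ(Ω)`. -/
def gammaLiminf {d : ℕ} {Φ : YoungFunction} {Ω : Opens (Euc d)}
    (F : ℕ → OrliczSpace Φ Ω → EReal) (u : OrliczSpace Φ Ω) : EReal :=
  ⨅ (w : ℕ → OrliczSpace Φ Ω) (_ : OrliczTendsto w u), liminf (fun j => F j (w j)) atTop

/-- The `Γ(L_Φ)`-upper limit: the infimum of `limsup_j F_j(u_j)` over all `u_j → u` in
`L_Φ(Ω)`. -/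
def gammaLimsup {d : ℕ} {Φ : YoungFunction} {Ω : Opens (Euc d)}
    (F : ℕ → OrliczSpace Φ Ω → EReal) (u : OrliczSpace Φ Ω) : EReal :=
  ⨅ (w : ℕ → OrliczSpace Φ Ω) (_ : OrliczTendsto w u), limsup (fun j => F j (w j)) atTop

end

/-! Given sequences `w j → u` and `v j → u` whose energies on `U` and `V` are below reals `a` and
`b`, the fundamental estimate supplies cut-offs `φ j`; glue them to `z j = φ j * w j + (1 - φ j) * v
j`. Since `z j - u` is a pointwise convex combination of `w j - u` and `v j - u`, it is dominated by
their maximum, so `z j → u` however `φ j` varies with `j`. The penalty is a modular of `w j - v j`,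
which tends to `0` because `Φ (s * t) ≤ s * Φ t` for `0 < s ≤ 1`. Hence the energy of `z j` is at
most `(1 + σ) * (a + b) + 2 * σ` whenever both bounds hold at `j` and `j` is large
(`FundamentalEstimate.exists_glued`). Let `σ → 0`, then let `a`, `b` decrease to the two limits. -/

namespace YoungFunction

lemma intervalIntegrable (Φ : YoungFunction) {b : ℝ} (hb : 0 ≤ b) :
    IntervalIntegrable Φ.density volume 0 b := by
  refine MonotoneOn.intervalIntegrable (Φ.density_mono.mono ?_)
  intro x hx
  exact le_trans (le_min le_rfl hb) hx.1

/-- Convexity of `Φ` with `Φ 0 = 0`: substitute `x ↦ s * x` in the integral and use that the density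
is nondecreasing. -/
lemma map_mul_le (Φ : YoungFunction) {s t : ℝ} (hs : 0 < s) (hs1 : s ≤ 1) (ht : 0 ≤ t) :
    Φ (s * t) ≤ s * Φ t := by
  have hst : 0 ≤ s * t := mul_nonneg hs.le ht
  rw [Φ.eq_integral _ hst, Φ.eq_integral t ht]
  have h := intervalIntegral.mul_integral_comp_mul_left (f := Φ.density) (a := 0) (b := t) s
  rw [mul_zero] at h
  rw [← h]
  refine mul_le_mul_of_nonneg_left ?_ hs.le
  refine intervalIntegral.integral_mono_on ht ?_ (Φ.intervalIntegrable ht) ?_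
  · refine MonotoneOn.intervalIntegrable fun x hx y hy hxy => ?_
    rw [Set.uIcc_of_le ht] at hx hy
    exact Φ.density_mono (mul_nonneg hs.le hx.1) (mul_nonneg hs.le hy.1)
      (mul_le_mul_of_nonneg_left hxy hs.le)
  · intro x hx
    exact Φ.density_mono (mul_nonneg hs.le hx.1) hx.1 (mul_le_of_le_one_left hx.1 hs1)

end YoungFunction

/-! ### Scaling estimates for the modular. -/

section Modular

variable {d : ℕ} {Φ : YoungFunction} {S : Set (Euc d)}

lemma orliczModular_mono_ae {f g : Euc d → ℝ}
    (h : ∀ᵐ x ∂volume.restrict S, |f x| ≤ |g x|) :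
    orliczModular Φ S f ≤ orliczModular Φ S g := by
  refine lintegral_mono_ae ?_
  filter_upwards [h] with x hx
  exact ENNReal.ofReal_le_ofReal
    (Φ.monotoneOn (Set.mem_Ici.2 (abs_nonneg _)) (Set.mem_Ici.2 (abs_nonneg _)) hx)

lemma orliczModular_div_le_one_of_luxemburgNorm_lt {f : Euc d → ℝ} {ε : ℝ}
    (h : luxemburgNorm Φ S f < ENNReal.ofReal ε) :
    orliczModular Φ S (fun x => f x / ε) ≤ 1 := by
  unfold luxemburgNorm at h
  simp only [iInf_lt_iff] at h
  obtain ⟨c, ⟨hc, hc1⟩, hlt⟩ := h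
  have hcε : c < ε := (ENNReal.ofReal_lt_ofReal_iff_of_nonneg hc.le).1 hlt
  refine le_trans (orliczModular_mono_ae (.of_forall fun x => ?_)) hc1
  rw [abs_div, abs_div, abs_of_pos hc, abs_of_pos (hc.trans hcε)]
  exact div_le_div_of_nonneg_left (abs_nonneg _) hc hcε.le

/-- Stands in for the triangle inequality: `Φ` of a maximum is at most the sum of the two values.
Taking `s = 1 / 2` gives norm bounds, small `s` gives small modulars. -/
lemma orliczModular_le_of_abs_le_mul_max {f g h : Euc d → ℝ} {s : ℝ} (hs : 0 < s) (hs1 : s ≤ 1)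
    (hfm : AEMeasurable f (volume.restrict S))
    (hle : ∀ᵐ x ∂volume.restrict S, |h x| ≤ s * max |f x| |g x|)
    (hf : orliczModular Φ S f ≤ 1) (hg : orliczModular Φ S g ≤ 1) :
    orliczModular Φ S h ≤ ENNReal.ofReal (2 * s) := by
  have hmeas : AEMeasurable (fun x => ENNReal.ofReal (Φ |f x|)) (volume.restrict S) :=
    (Φ.measurable_comp_abs.comp_aemeasurable hfm).ennreal_ofReal
  have key : orliczModular Φ S h ≤
      ENNReal.ofReal s * (orliczModular Φ S f + orliczModular Φ S g) := by
    unfold orliczModular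
    rw [← lintegral_add_left' hmeas, ← lintegral_const_mul' _ _ ENNReal.ofReal_ne_top]
    refine lintegral_mono_ae ?_
    filter_upwards [hle] with x hx
    have hm : 0 ≤ max |f x| |g x| := le_max_of_le_left (abs_nonneg _)
    have h1 : Φ |h x| ≤ s * Φ (max |f x| |g x|) :=
      (Φ.monotoneOn (Set.mem_Ici.2 (abs_nonneg _)) (Set.mem_Ici.2 (mul_nonneg hs.le hm)) hx).trans
        (Φ.map_mul_le hs hs1 hm)
    refine (ENNReal.ofReal_le_ofReal h1).trans ?_
    rw [ENNReal.ofReal_mul hs.le]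
    gcongr
    rcases le_total |f x| |g x| with hfg | hfg
    · rw [max_eq_right hfg]
      exact le_add_self
    · rw [max_eq_left hfg]
      exact le_self_add
  calc orliczModular Φ S h
      ≤ ENNReal.ofReal s * (orliczModular Φ S f + orliczModular Φ S g) := key
    _ ≤ ENNReal.ofReal s * (1 + 1) := by gcongr
    _ = ENNReal.ofReal (2 * s) := by
      rw [one_add_one_eq_two, mul_comm, ENNReal.ofReal_mul two_pos.le, ENNReal.ofReal_ofNat]

end Modular

/-! ### Norm convergence under gluing, and the penalty term. -/

section Convergence

variable {d : ℕ} {Φ : YoungFunction} {Ω : Opens (Euc d)}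

lemma OrliczTendsto.eventually_lt {w : ℕ → OrliczSpace Φ Ω} {u : OrliczSpace Φ Ω}
    (hw : OrliczTendsto w u) {ε : ℝ} (hε : 0 < ε) :
    ∀ᶠ j in atTop, luxemburgNorm Φ (Ω : Set (Euc d)) ((w j).1 - u.1 : MeasClass Ω) <
      ENNReal.ofReal ε :=
  (tendsto_order.1 hw).2 _ (ENNReal.ofReal_pos.2 hε)

lemma luxemburgNorm_self_sub (u : OrliczSpace Φ Ω) :
    luxemburgNorm Φ (Ω : Set (Euc d)) (u.1 - u.1 : MeasClass Ω) = 0 := by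
  refine le_antisymm (le_of_forall_gt fun r hr => ?_) bot_le
  obtain ⟨c, hc0, hc⟩ := ENNReal.lt_iff_exists_nnreal_btwn.1 hr
  have hc0' : (0 : ℝ) < c := by exact_mod_cast hc0
  refine lt_of_le_of_lt (iInf₂_le (c : ℝ) ⟨hc0', ?_⟩) (by simpa using hc)
  have hz : orliczModular Φ (Ω : Set (Euc d))
      (fun x => (u.1 - u.1 : MeasClass Ω) x / c) = 0 := by
    have hΦ : Φ 0 = 0 := by rw [Φ.eq_integral 0 le_rfl, intervalIntegral.integral_same]
    unfold orliczModular
    refine (lintegral_congr_ae ?_).trans lintegral_zero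
    filter_upwards [AEEqFun.coeFn_sub u.1 u.1] with x hx
    rw [hx, Pi.sub_apply, sub_self, zero_div, abs_zero, hΦ, ENNReal.ofReal_zero]
  rw [hz]
  exact zero_le_one

lemma CutOff.luxemburgNorm_blend_sub_le {U' U : Opens (Euc d)} (φ : CutOff U' U)
    {u v w : OrliczSpace Φ Ω} {ε : ℝ} (hε : 0 < ε)
    (hw : luxemburgNorm Φ (Ω : Set (Euc d)) (w.1 - u.1 : MeasClass Ω) < ENNReal.ofReal ε)
    (hv : luxemburgNorm Φ (Ω : Set (Euc d)) (v.1 - u.1 : MeasClass Ω) < ENNReal.ofReal ε) :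
    luxemburgNorm Φ (Ω : Set (Euc d)) ((φ.blend w v).1 - u.1 : MeasClass Ω) ≤
      ENNReal.ofReal (2 * ε) := by
  refine iInf₂_le (2 * ε) ⟨by positivity, ?_⟩
  -- Dividing by `2 * ε` instead of `ε` yields `s = 1 / 2`, so the two modulars, each at most `1`,
  -- add up to at most `1`.
  refine (orliczModular_le_of_abs_le_mul_max (s := 1 / 2) (by norm_num) (by norm_num)
    ((w.1 - u.1).aestronglyMeasurable.aemeasurable.div_const ε) ?_
    (orliczModular_div_le_one_of_luxemburgNorm_lt hw)
    (orliczModular_div_le_one_of_luxemburgNorm_lt hv)).trans (by norm_num)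
  filter_upwards [AEEqFun.coeFn_add (φ.toClass Ω * w.1) ((1 - φ.toClass Ω) * v.1),
      AEEqFun.coeFn_mul (φ.toClass Ω) w.1, AEEqFun.coeFn_mul (1 - φ.toClass Ω) v.1,
      AEEqFun.coeFn_sub 1 (φ.toClass Ω),
      (AEEqFun.coeFn_one : ((1 : MeasClass Ω) : Euc d → ℝ) =ᵐ[_] 1),
      AEEqFun.coeFn_mk φ.toFun φ.smooth.continuous.aestronglyMeasurable,
      AEEqFun.coeFn_sub (φ.blend w v).1 u.1, AEEqFun.coeFn_sub w.1 u.1,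
      AEEqFun.coeFn_sub v.1 u.1] with x h1 h2 h3 h4 h5 h6 h7 h8 h9
  have h6' : (φ.toClass Ω) x = φ.toFun x := h6
  have hb : (φ.blend w v).1 x = φ.toFun x * w.1 x + (1 - φ.toFun x) * v.1 x := by
    refine h1.trans ?_
    simp only [Pi.add_apply, h2, Pi.mul_apply, h3, h4, Pi.sub_apply, h5, Pi.one_apply, h6']
  simp only [h7, h8, h9, Pi.sub_apply, hb]
  have p0 := φ.nonneg x
  have p1 := sub_nonneg.2 (φ.le_one x)
  have hle : |φ.toFun x * w.1 x + (1 - φ.toFun x) * v.1 x - u.1 x| ≤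
      max |w.1 x - u.1 x| |v.1 x - u.1 x| := by
    calc |φ.toFun x * w.1 x + (1 - φ.toFun x) * v.1 x - u.1 x|
        = |φ.toFun x * (w.1 x - u.1 x) + (1 - φ.toFun x) * (v.1 x - u.1 x)| := by
          congr 1; ring
      _ ≤ φ.toFun x * |w.1 x - u.1 x| + (1 - φ.toFun x) * |v.1 x - u.1 x| := by
          refine (abs_add_le _ _).trans_eq ?_
          rw [abs_mul, abs_mul, abs_of_nonneg p0, abs_of_nonneg p1]
      _ ≤ φ.toFun x * max |w.1 x - u.1 x| |v.1 x - u.1 x| +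
          (1 - φ.toFun x) * max |w.1 x - u.1 x| |v.1 x - u.1 x| :=
          add_le_add (mul_le_mul_of_nonneg_left (le_max_left _ _) p0)
            (mul_le_mul_of_nonneg_left (le_max_right _ _) p1)
      _ = max |w.1 x - u.1 x| |v.1 x - u.1 x| := by ring
  rw [abs_div, abs_div, abs_div, abs_of_pos hε, abs_of_pos (by positivity : 0 < 2 * ε),
    max_div_div_right hε.le]
  calc _ ≤ max |w.1 x - u.1 x| |v.1 x - u.1 x| / (2 * ε) := by gcongr
    _ = _ := by field_simp

lemma orliczModular_sub_le {S : Set (Euc d)} (hS : S ⊆ (Ω : Set (Euc d)))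
    {u v w : OrliczSpace Φ Ω} {ε : ℝ} (hε : 0 < ε) (hε1 : 2 * ε ≤ 1)
    (hw : luxemburgNorm Φ (Ω : Set (Euc d)) (w.1 - u.1 : MeasClass Ω) < ENNReal.ofReal ε)
    (hv : luxemburgNorm Φ (Ω : Set (Euc d)) (v.1 - u.1 : MeasClass Ω) < ENNReal.ofReal ε) :
    orliczModular Φ S (w.1 - v.1 : MeasClass Ω) ≤ ENNReal.ofReal (2 * (2 * ε)) := by
  refine (lintegral_mono_set hS).trans ?_
  refine orliczModular_le_of_abs_le_mul_max (s := 2 * ε) (by positivity) hε1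
    ((w.1 - u.1).aestronglyMeasurable.aemeasurable.div_const ε) ?_
    (orliczModular_div_le_one_of_luxemburgNorm_lt hw)
    (orliczModular_div_le_one_of_luxemburgNorm_lt hv)
  filter_upwards [AEEqFun.coeFn_sub w.1 v.1, AEEqFun.coeFn_sub w.1 u.1,
    AEEqFun.coeFn_sub v.1 u.1] with x h1 h2 h3
  simp only [h1, h2, h3, Pi.sub_apply]
  rw [abs_div, abs_div, abs_of_pos hε, max_div_div_right hε.le]
  have e : 2 * ε * (max |w.1 x - u.1 x| |v.1 x - u.1 x| / ε) =
      max |w.1 x - u.1 x| |v.1 x - u.1 x| + max |w.1 x - u.1 x| |v.1 x - u.1 x| := by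
    field_simp; ring
  rw [e]
  calc |w.1 x - v.1 x| = |(w.1 x - u.1 x) - (v.1 x - u.1 x)| := by congr 1; ring
    _ ≤ |w.1 x - u.1 x| + |v.1 x - u.1 x| := abs_sub _ _
    _ ≤ _ := add_le_add (le_max_left _ _) (le_max_right _ _)

end Convergence

/-! ### Limit passages in the extended reals. -/

lemma EReal.le_coe_of_forall_pos_le {X : EReal} {c : ℝ}
    (h : ∀ σ : ℝ, 0 < σ → X ≤ (((1 + σ) * c + 2 * σ : ℝ) : EReal)) : X ≤ (c : EReal) := by
  have hc : Continuous fun σ : ℝ => (1 + σ) * c + 2 * σ := by fun_prop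
  have ht : Tendsto (fun σ : ℝ => (1 + σ) * c + 2 * σ) (𝓝[>] 0) (𝓝 c) := by
    have := (hc.tendsto 0).mono_left (nhdsWithin_le_nhds (s := Set.Ioi 0))
    simpa using this
  refine ge_of_tendsto ((continuous_coe_real_ereal.tendsto c).comp ht) ?_
  filter_upwards [self_mem_nhdsWithin] with σ hσ
  exact h σ hσ

/-- Reduces to real bounds, for which the arithmetic of the gluing estimate is harmless.
`SumDefined` is needed because `⊤ + ⊥ = ⊥` in `EReal`. -/
lemma EReal.le_add_of_forall_coe_gt {X a b : EReal} (hab : SumDefined a b)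
    (h : ∀ a' b' : ℝ, a < a' → b < b' → X ≤ ((a' + b' : ℝ) : EReal)) : X ≤ a + b := by
  refine EReal.le_add_of_forall_gt ?_ ?_ fun a' ha b' hb => ?_
  · by_contra hc
    push Not at hc
    exact hab.2 hc
  · by_contra hc
    push Not at hc
    exact hab.1 hc
  · induction a' with
    | bot => exact absurd ha not_lt_bot
    | top =>
      rw [EReal.top_add_of_ne_bot (ne_bot_of_gt hb)]
      exact le_top
    | coe a' =>
      induction b' with
      | bot => exact absurd hb not_lt_bot
      | top =>
        rw [EReal.coe_add_top]
        exact le_top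
      | coe b' => exact_mod_cast h a' b' ha hb

/-- Two approximating sequences can be glued along cut-off functions, at the cost of an
arbitrarily small error in the energy. -/
lemma FundamentalEstimate.exists_glued {d : ℕ} {Φ : YoungFunction} {Ω : Opens (Euc d)}
    {A : Set (Euc d)} (hA : A ⊆ (Ω : Set (Euc d)))
    {F : ℝ → OrliczSpace Φ Ω → Opens (Euc d) → EReal} (hF : FundamentalEstimate A F)
    {n : ℕ → ℝ} (hn_pos : ∀ j, 0 < n j) (hn : Tendsto n atTop (𝓝 0))
    {u : OrliczSpace Φ Ω} {U U' V : Opens (Euc d)}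
    (hU : (U : Set (Euc d)) ⊆ A) (hU' : (U' : Set (Euc d)) ⊆ A) (hV : (V : Set (Euc d)) ⊆ A)
    (hU'U : CompactlyContained U' U) {w v : ℕ → OrliczSpace Φ Ω}
    (hw : OrliczTendsto w u) (hv : OrliczTendsto v u) (a b : ℝ) {σ : ℝ} (hσ : 0 < σ) :
    ∃ z : ℕ → OrliczSpace Φ Ω, OrliczTendsto z u ∧ ∀ᶠ j in atTop,
      F (n j) (w j) U < a → F (n j) (v j) V < b →
        F (n j) (z j) (U' ⊔ V) ≤ (((1 + σ) * (a + b) + 2 * σ : ℝ) : EReal) := by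
  obtain ⟨M, hM, n₀, hn₀, hest⟩ := hF U U' V hU hU' hV hU'U σ hσ
  -- Where the estimate does not apply, `z = u` is a default that cannot spoil convergence.
  have hz : ∀ j, ∃ z : OrliczSpace Φ Ω, (z = u ∨ ∃ φ : CutOff U' U, z = φ.blend (w j) (v j)) ∧
      (n j ≤ n₀ → SumDefined (F (n j) (w j) U) (F (n j) (v j) V) →
        F (n j) z (U' ⊔ V) ≤
            ((1 + σ : ℝ) : EReal) * (F (n j) (w j) U + F (n j) (v j) V)
              + (M : EReal) * ((orliczModular Φ (((U : Set (Euc d)) ∩ V) \ U')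
                  ((w j).1 - (v j).1 : MeasClass Ω) : ℝ≥0∞) : EReal)
              + (σ : EReal)) := by
    intro j
    by_cases h : n j ≤ n₀ ∧ SumDefined (F (n j) (w j) U) (F (n j) (v j) V)
    · obtain ⟨φ, hφ⟩ := hest (n j) (hn_pos j) h.1 (w j) (v j) h.2
      exact ⟨_, .inr ⟨φ, rfl⟩, fun _ _ => hφ⟩
    · exact ⟨u, .inl rfl, fun h1 h2 => absurd ⟨h1, h2⟩ h⟩
  choose z hz hzest using hz
  refine ⟨z, ?_, ?_⟩
  · refine ENNReal.tendsto_nhds_zero.2 fun r hr => ?_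
    obtain ⟨c, hc0, hc⟩ := ENNReal.lt_iff_exists_nnreal_btwn.1 hr
    have hc0' : (0 : ℝ) < c := by exact_mod_cast hc0
    filter_upwards [hw.eventually_lt (half_pos hc0'), hv.eventually_lt (half_pos hc0')]
      with j h1 h2
    rcases hz j with h | ⟨φ, h⟩
    · rw [h, luxemburgNorm_self_sub]
      exact bot_le
    · rw [h]
      refine (φ.luxemburgNorm_blend_sub_le (half_pos hc0') h1 h2).trans ?_
      rw [mul_div_cancel₀ _ two_ne_zero, ENNReal.ofReal_coe_nnreal]
      exact hc.le
  -- The penalty is at most `M * (4 * ε)`, so this choice makes it at most `σ`; `1 / 2` keeps the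
  -- scaling factor `2 * ε` at most `1`.
  · set ε : ℝ := min (1 / 2) (σ / (4 * M)) with hε
    have hε0 : 0 < ε := by positivity
    have hε1 : 2 * ε ≤ 1 := by linarith [min_le_left (1 / 2) (σ / (4 * M))]
    have hε2 : M * (2 * (2 * ε)) ≤ σ := by
      have h := min_le_right (1 / 2) (σ / (4 * M))
      rw [← hε, le_div_iff₀ (by positivity)] at h
      linarith
    filter_upwards [hw.eventually_lt hε0, hv.eventually_lt hε0,
      hn.eventually (eventually_le_nhds hn₀)] with j h1 h2 h3 ha hb
    -- Neither energy is `⊤`, being below a real number.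
    have hsum : SumDefined (F (n j) (w j) U) (F (n j) (v j) V) :=
      ⟨fun h => ne_top_of_lt ha h.1, fun h => ne_top_of_lt hb h.2⟩
    have hmod : ((orliczModular Φ (((U : Set (Euc d)) ∩ V) \ U')
        ((w j).1 - (v j).1 : MeasClass Ω) : ℝ≥0∞) : EReal) ≤ ((2 * (2 * ε) : ℝ) : EReal) := by
      have h := orliczModular_sub_le (S := ((U : Set (Euc d)) ∩ V) \ U')
        (fun x hx => hA (hU hx.1.1)) hε0 hε1 h1 h2
      refine (EReal.coe_ennreal_le_coe_ennreal_iff.2 h).trans_eq ?_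
      rw [EReal.coe_ennreal_ofReal, max_eq_left (by positivity)]
    refine (hzest j h3 hsum).trans ?_
    calc _ ≤ ((1 + σ : ℝ) : EReal) * ((a : EReal) + b)
          + (M : EReal) * ((2 * (2 * ε) : ℝ) : EReal) + (σ : EReal) := by
          refine add_le_add (add_le_add ?_ ?_) le_rfl
          · exact mul_le_mul_of_nonneg_left (add_le_add ha.le hb.le)
              (EReal.coe_nonneg.2 (by positivity))
          · exact mul_le_mul_of_nonneg_left hmod (EReal.coe_nonneg.2 hM.le)
      _ = (((1 + σ) * (a + b) + M * (2 * (2 * ε)) + σ : ℝ) : EReal) := by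
          simp only [EReal.coe_add, EReal.coe_mul]
      _ ≤ _ := EReal.coe_le_coe_iff.2 (by linarith)

theorem proposition8 {d : ℕ} (Φ : YoungFunction) (Ω : Opens (Euc d)) (A : Set (Euc d))
    (hA : A ⊆ (Ω : Set (Euc d)))
    (F : ℝ → OrliczSpace Φ Ω → Opens (Euc d) → EReal)
    (hF : FundamentalEstimate A F)
    (n : ℕ → ℝ) (hn_pos : ∀ j, 0 < n j) (hn : Tendsto n atTop (𝓝 0))
    (F' F'' : OrliczSpace Φ Ω → Opens (Euc d) → EReal)
    (hF' : ∀ u U, F' u U = gammaLiminf (fun j w => F (n j) w U) u)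
    (hF'' : ∀ u U, F'' u U = gammaLimsup (fun j w => F (n j) w U) u)
    (u : OrliczSpace Φ Ω) (U U' V : Opens (Euc d))
    (hU : (U : Set (Euc d)) ⊆ A) (hU' : (U' : Set (Euc d)) ⊆ A) (hV : (V : Set (Euc d)) ⊆ A)
    (hU'U : CompactlyContained U' U) :
    (SumDefined (F' u U) (F'' u V) → F' u (U' ⊔ V) ≤ F' u U + F'' u V) ∧
    (SumDefined (F'' u U) (F'' u V) → F'' u (U' ⊔ V) ≤ F'' u U + F'' u V) := by

  simp only [hF', hF'']
  refine ⟨fun hs => ?_, fun hs => ?_⟩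
  all_goals
    refine EReal.le_add_of_forall_coe_gt hs fun a b ha hb =>
      EReal.le_coe_of_forall_pos_le fun σ hσ => ?_
    simp only [gammaLiminf, gammaLimsup, iInf_lt_iff] at ha hb
    obtain ⟨w, hw, hwa⟩ := ha
    obtain ⟨v, hv, hvb⟩ := hb
    obtain ⟨z, hz, hle⟩ := hF.exists_glued hA hn_pos hn hU hU' hV hU'U hw hv a b hσ
    refine (iInf₂_le z hz).trans ?_
    have hvb' := eventually_lt_of_limsup_lt hvb
  -- The bound on `U` holds only for infinitely many `j`; the `limsup` on `V` gives its bound for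
  -- all large `j`, so both hold together infinitely often.
  · refine liminf_le_of_frequently_le' ?_
    exact ((frequently_lt_of_liminf_lt (by isBoundedDefault) hwa).and_eventually
      (hvb'.and hle)).mono fun j h => h.2.2 h.1 h.2.1
  · refine limsup_le_of_le (by isBoundedDefault) ?_
    filter_upwards [eventually_lt_of_limsup_lt hwa, hvb', hle] with j h1 h2 h3
    exact h3 h1 h2
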